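/- **Definitions.** A signed hypergraph $H=(V,S)$ consists of a finite set $V$ of nodes and a finite set $S$ of signed edges; a signed edge is a pair $s=(e,\eta_s)$ with $e\subseteq V$, $|e|\ge 2$, and $\eta_s:e\to\{-1,+1\}$ (distinct signed edges may have the same underlying edge $e$). Assume $S\neq\emptyset$; the rank of $H$ is the maximum of $|e|$ over all $(e,\eta_s)\in S$. The underlying hypergraph of $H$ has node set $V$, and its edges are the sets $e$ with $(e,\eta_s)\in S$ for some $\eta_s$. For a hypergraph $G=(V,E)$ and $v\in V$, let $G-v$ be the hypergraph with node set $V\setminus\{v\}$ and edge set $\{e\setminus\{v\}: e\in E,\ e\setminus\{v\}\ne\emptyset\}$. The node $v$ is an $\alpha$-leaf of $G$ if either no edge of $G$ contains $v$, or some edge containing $v$ includes every edge containing $v$. The hypergraph $G$ is $\alpha$-acyclic if its nodes can be ordered as $v_1,\dots,v_n$, $n=|V|$, so that $v_i$ is an $\alpha$-leaf of $G-v_1-\cdots-v_{i-1}$ for every $i$. The pseudo-Boolean polytope $\mathrm{PBP}(H)\subset\mathbb{R}^{V\cup S}$ is the convex hull of $$\Big\{z\in\{0,1\}^{V\cup S}:\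 z_s=\prod_{v\in e,\ \eta_s(v)=+1}z_v\prod_{v\in e,\ \eta_s(v)=-1}(1-z_v)\ \text{ for all } s=(e,\eta_s)\in S\Big\}.$$ An extended formulation of $\mathrm{PBP}(H)$ is a finite system of linear inequalities $A(z,y)\le b$ such that $\mathrm{PBP}(H)=\{z:\exists y,\ A(z,y)\le b\}$; its variables are all components of $z$ and of $y$, and an equation is written as inequalities. **Theorem.** (1) Let $H=(V,S)$ be a signed hypergraph of rank $r$ whose underlying hypergraph is $\alpha$-acyclic. Then $\mathrm{PBP}(H)$ has an extended formulation with at most $$\Big(\tfrac23\,3^r+2(r-1)(2^r+1)\Big)|V|$$ variables and at most this many inequalities, in which all coefficients and right-hand side constants are $0,\pm1$. (2) In particular, if $r=O(\log \mathrm{poly}(|V|,|S|))$, then $\mathrm{PBP}(H)$ has a polynomial-size extended formulation. That is, for every real $C$ and every polynomial $p$ in two variables with nonnegative integer coefficients there is a polynomial $q$ in two variables with nonnegative integer coefficients, depending only on $C$ and $p$, such that for every signed hypergraph $H=(V,S)$ with $\alpha$-acyclic underlying hypergraph and rank $r\le C\log p(|V|,|S|)$, the polytope $\mathrm{PBP}(H)$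 has an extended formulation with at most $q(|V|,|S|)$ variables and at most $q(|V|,|S|)$ inequalities, in which all coefficients and right-hand side constants are $0,\pm1$. -/

import Mathlib

universe u

/-- A finite hypergraph with nodes in `α`. Singleton edges are allowed because deleting a node can
create them. -/
structure FinHypergraph (α : Type u) where
  nodes : Finset α
  edges : Finset (Finset α)
  subset_nodes : ∀ e ∈ edges, e ⊆ nodes
  nonempty_edges : ∀ e ∈ edges, e.Nonempty

namespace FinHypergraph

variable {α : Type u} [DecidableEq α]

/-- `G - v`: delete the node `v` from the node set and from every edge, and drop empty edges. -/
def remove (G : FinHypergraph α) (v : α) : FinHypergraph α where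
  nodes := G.nodes.erase v
  edges := (G.edges.image fun e => e.erase v).filter fun e => e.Nonempty
  subset_nodes := by
    intro e he
    obtain ⟨f, hf, rfl⟩ := Finset.mem_image.mp (Finset.mem_filter.mp he).1
    exact Finset.erase_subset_erase v (G.subset_nodes f hf)
  nonempty_edges := fun e he => (Finset.mem_filter.mp he).2

/-- `v` is an `α`-leaf: among the edges containing `v` (if there are any) one contains all others.
A node that lies in no edge counts as an `α`-leaf. -/
def IsAlphaLeaf (G : FinHypergraph α) (v : α) : Prop :=
  v ∈ G.nodes ∧
    ((∃ e ∈ G.edges, v ∈ e) → ∃ e ∈ G.edges, v ∈ e ∧ ∀ f ∈ G.edges, v ∈ f → f ⊆ e)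

/-- `v₁, …, v_t` is a sequence of `α`-leaves: `v₁` is an `α`-leaf of `G`, `v₂` one of `G - v₁`, and
so on. The nodes are automatically distinct, as each is a node of the remaining hypergraph. -/
def IsAlphaLeafSeq : FinHypergraph α → List α → Prop
  | _, [] => True
  | G, v :: l => G.IsAlphaLeaf v ∧ IsAlphaLeafSeq (G.remove v) l

/-- `G` has a sequence of `α`-leaves of length `|V|`. -/
def IsAlphaAcyclic (G : FinHypergraph α) : Prop :=
  ∃ l : List α, l.length = G.nodes.card ∧ G.IsAlphaLeafSeq l

end FinHypergraph

/-- A signed edge: an underlying edge together with a sign `±1` for each of its nodes. -/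
abbrev SignedEdge (α : Type u) : Type u := Σ e : Finset α, (e → ℤˣ)

/-- A signed hypergraph. Signed edges form a set, so no two are identical, but parallel ones
(equal underlying edge, different signs) may occur. -/
structure SignedHypergraph (α : Type u) where
  nodes : Finset α
  edges : Finset (SignedEdge α)
  subset_nodes : ∀ s ∈ edges, s.1 ⊆ nodes
  two_le_card : ∀ s ∈ edges, 2 ≤ s.1.card

/-- `σ_s(x)`: equal to `x` for the sign `+1` and to `1 - x` for the sign `-1`. -/
noncomputable def signedLiteral (ε : ℤˣ) (x : ℝ) : ℝ := if ε = 1 then x else 1 - x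

namespace SignedHypergraph

variable {α : Type u}

/-- The underlying hypergraph: forget the signs and identify parallel edges. -/
def underlying [DecidableEq α] (H : SignedHypergraph α) : FinHypergraph α where
  nodes := H.nodes
  edges := H.edges.image fun s => s.1
  subset_nodes := by
    intro e he
    obtain ⟨s, hs, rfl⟩ := Finset.mem_image.mp he
    exact H.subset_nodes s hs
  nonempty_edges := by
    intro e he
    obtain ⟨s, hs, rfl⟩ := Finset.mem_image.mp he
    exact Finset.card_pos.mp (lt_of_lt_of_le Nat.zero_lt_two (H.two_le_card s hs))

/-- The rank: the maximum cardinality of an edge (meaningful when there is an edge). -/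
def rank (H : SignedHypergraph α) : ℕ := H.edges.sup fun s => s.1.card

/-- The index set `V ∪ S` (disjoint union) of the coordinates. -/
abbrev Coord (H : SignedHypergraph α) : Type u := H.nodes ⊕ H.edges

/-- The pseudo-Boolean set. -/
def pseudoBooleanSet (H : SignedHypergraph α) : Set (H.Coord → ℝ) :=
  {z | (∀ i, z i = 0 ∨ z i = 1) ∧
    ∀ s : H.edges, z (Sum.inr s) =
      ∏ v : s.1.1, signedLiteral (s.1.2 v) (z (Sum.inl ⟨v.1, H.subset_nodes s.1 s.2 v.2⟩))}

/-- The pseudo-Boolean polytope. -/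
def pseudoBooleanPolytope (H : SignedHypergraph α) : Set (H.Coord → ℝ) :=
  convexHull ℝ H.pseudoBooleanSet

end SignedHypergraph

/-- A finite system of linear inequalities `A (z, y) ≤ b` in the variables `z` indexed by `ι` and
`numAux` additional variables `y`. An equation has to be written as inequalities. -/
structure LinearSystem (ι : Type u) where
  numAux : ℕ
  numIneqs : ℕ
  A : Matrix (Fin numIneqs) (ι ⊕ Fin numAux) ℝ
  b : Fin numIneqs → ℝ

namespace LinearSystem

variable {ι : Type u} [Fintype ι]

/-- The number of all variables, both the original ones and the additional ones. -/
def numVars (L : LinearSystem ι) : ℕ := Fintype.card ι + L.numAux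

/-- `L` is an extended formulation of `P`: the projection of its solution set onto the space of
the variables `z` is `P`. -/
def IsExtendedFormulationOf (L : LinearSystem ι) (P : Set (ι → ℝ)) : Prop :=
  {z : ι → ℝ | ∃ y : Fin L.numAux → ℝ, L.A.mulVec (Sum.elim z y) ≤ L.b} = P

/-- All coefficients and right-hand side constants are `0` or `±1`. -/
def HasZeroOneNegOneData (L : LinearSystem ι) : Prop :=
  (∀ i j, L.A i j = 0 ∨ L.A i j = 1 ∨ L.A i j = -1) ∧
    ∀ i, L.b i = 0 ∨ L.b i = 1 ∨ L.b i = -1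

end LinearSystem

/-! Let `T` be the random set of nodes with value 1. A point of the polytope is a vector of pattern
probabilities: each coordinate is the probability that `T` meets its support (a node or an edge) in
exactly the positively signed nodes (`pseudoBooleanSet_eq`, `convexHull_patternVector`).

Eliminating α-leaves arranges the nodes in a forest. The bag of `v` is the largest remaining edge at
`v`, or `{v}`, and every edge lies in the bag of one of its own nodes
(`IsAlphaLeafSeq.exists_isElimTree`). The auxiliary variables form one distribution on the subsets
of each bag, and each has to agree with the parent's distribution on the bag minus `v`. Such local
distributions come from a global one: run through the elimination order backwards and add each node
conditionally independent of the rest, given its bag (`exists_glue`,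
`IsElimTree.exists_distribution`). The coordinates are then marginals of local distributions, hence
linear in the auxiliary variables (`IsElimTree.exists_isFeasible_iff`).

To keep the system small, equations are not split in two. A family of termwise inequalities together
with one reverse inequality between the totals already forces equality everywhere. -/

namespace FinHypergraph

variable {α : Type u} [DecidableEq α]

/-! ### Elimination trees of α-acyclic hypergraphs -/

/-- The list `l` eliminates its nodes one after the other. When `v` is eliminated, `bag v` consists
of `v` and of nodes that come later, and unless `bag v = {v}`, these later nodes all lie in the bag
of the later node `par v`. -/
def IsElimTree (bag : α → Finset α) (par : α → α) : List α → Prop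
  | [] => True
  | v :: l => v ∉ l ∧ v ∈ bag v ∧ (bag v).erase v ⊆ l.toFinset ∧
      (bag v = {v} ∨ par v ∈ l ∧ (bag v).erase v ⊆ bag (par v)) ∧ IsElimTree bag par l

theorem IsElimTree.congr {bag bag' : α → Finset α} {par par' : α → α} :
    ∀ {l : List α}, IsElimTree bag par l → (∀ v ∈ l, bag' v = bag v ∧ par' v = par v) →
      IsElimTree bag' par' l
  | [], _, _ => trivial
  | v :: l, ⟨h1, h2, h3, h4, h5⟩, h => by
    have hv := h v (by simp)
    refine ⟨h1, hv.1 ▸ h2, hv.1 ▸ h3, ?_, h5.congr fun w hw => h w (by simp [hw])⟩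
    rcases h4 with h4 | ⟨h4, h6⟩
    · exact Or.inl (hv.1.trans h4)
    · right
      rw [hv.1, hv.2, (h (par v) (by simp [h4])).1]
      exact ⟨h4, h6⟩

theorem IsElimTree.mem_bag {bag : α → Finset α} {par : α → α} :
    ∀ {l : List α}, IsElimTree bag par l → ∀ v ∈ l, v ∈ bag v
  | _ :: _, ⟨_, h2, _, _, h5⟩, v, hv => by
    rcases List.mem_cons.1 hv with rfl | hv
    · exact h2
    · exact h5.mem_bag v hv

theorem IsElimTree.bag_subset {bag : α → Finset α} {par : α → α} :
    ∀ {l : List α}, IsElimTree bag par l → ∀ v ∈ l, bag v ⊆ l.toFinset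
  | w :: l, ⟨_, _, h3, _, h5⟩, v, hv => by
    rw [List.toFinset_cons]
    rcases List.mem_cons.1 hv with rfl | hv
    · exact Finset.subset_insert_iff.2 h3
    · exact (h5.bag_subset v hv).trans (Finset.subset_insert _ _)

theorem IsElimTree.par_spec {bag : α → Finset α} {par : α → α} :
    ∀ {l : List α}, IsElimTree bag par l → ∀ v ∈ l, bag v ≠ {v} →
      par v ∈ l ∧ par v ≠ v ∧ (bag v).erase v ⊆ bag (par v)
  | w :: l, ⟨h1, _, _, h4, h5⟩, v, hv, hb => by
    rcases List.mem_cons.1 hv with rfl | hv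
    · obtain ⟨h6, h7⟩ := h4.resolve_left hb
      exact ⟨List.mem_cons_of_mem _ h6, fun h => h1 (h ▸ h6), h7⟩
    · obtain ⟨h6, h7⟩ := h5.par_spec v hv hb
      exact ⟨List.mem_cons_of_mem _ h6, h7⟩

theorem IsAlphaLeaf.exists_bag {G : FinHypergraph α} {v : α} (hv : G.IsAlphaLeaf v) {r : ℕ}
    (hr : 1 ≤ r) (hG : ∀ e ∈ G.edges, e.card ≤ r) :
    ∃ B : Finset α, v ∈ B ∧ B ⊆ G.nodes ∧ B.card ≤ r ∧ (∀ f ∈ G.edges, v ∈ f → f ⊆ B) ∧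
      (B = {v} ∨ B.erase v ∈ (G.remove v).edges) := by
  by_cases h : ∃ e ∈ G.edges, v ∈ e
  · obtain ⟨e, he, hve, hf⟩ := hv.2 h
    refine ⟨e, hve, G.subset_nodes e he, hG e he, hf, ?_⟩
    rcases (e.erase v).eq_empty_or_nonempty with h0 | h0
    · left
      rw [← Finset.insert_erase hve, h0]
      rfl
    · exact Or.inr (Finset.mem_filter.2 ⟨Finset.mem_image_of_mem _ he, h0⟩)
  · push Not at h
    exact ⟨{v}, by simp, by simpa using hv.1, by simpa using hr,
      fun f hf hvf => absurd hvf (h f hf), Or.inl rfl⟩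

/-- The last clause drives the induction. If the bag `B` of the leaf `v` is not `{v}`, then `B.erase
v` is an edge of `G - v`, so it lies in the bag of some later node, which serves as the parent of
`v`. -/
theorem IsAlphaLeafSeq.exists_isElimTree {r : ℕ} (hr : 1 ≤ r) :
    ∀ {l : List α} {G : FinHypergraph α}, G.IsAlphaLeafSeq l → l.length = G.nodes.card →
      (∀ e ∈ G.edges, e.card ≤ r) → ∃ (bag : α → Finset α) (par : α → α),
        IsElimTree bag par l ∧ l.toFinset = G.nodes ∧ (∀ v ∈ l, (bag v).card ≤ r) ∧
          ∀ e ∈ G.edges, ∃ v ∈ l, v ∈ e ∧ e ⊆ bag v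
  | [], G, _, hl, _ => by
    have h0 : G.nodes = ∅ := Finset.card_eq_zero.1 hl.symm
    refine ⟨fun _ => ∅, id, trivial, by simp [h0], by simp, fun e he => ?_⟩
    obtain ⟨x, hx⟩ := G.nonempty_edges e he
    simpa [h0] using G.subset_nodes e he hx
  | v :: l, G, ⟨hv, hs⟩, hl, hG => by
    have hcard : l.length = (G.remove v).nodes.card := by
      have := Finset.card_erase_of_mem hv.1
      simp only [List.length_cons] at hl
      simp only [remove]
      omega
    obtain ⟨bag, par, ht, hn, hb, he⟩ := hs.exists_isElimTree hr hcard (by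
      intro e he
      obtain ⟨f, hf, rfl⟩ := Finset.mem_image.mp (Finset.mem_filter.mp he).1
      exact Finset.card_erase_le.trans (hG f hf))
    obtain ⟨B, hvB, hBn, hBr, hBe, hB⟩ := hv.exists_bag hr hG
    have hn' : l.toFinset = G.nodes.erase v := hn
    have hvl : v ∉ l := by
      rw [← List.mem_toFinset, hn']
      simp
    have hw : ∃ w, B = {v} ∨ w ∈ l ∧ B.erase v ⊆ bag w := by
      rcases hB with hB | hB
      · exact ⟨v, Or.inl hB⟩
      · obtain ⟨w, hw, -, hw'⟩ := he _ hB
        exact ⟨w, Or.inr ⟨hw, hw'⟩⟩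
    obtain ⟨w, hw⟩ := hw
    have hne : ∀ x ∈ l, x ≠ v := fun x hx h => hvl (h ▸ hx)
    refine ⟨Function.update bag v B, Function.update par v w, ⟨hvl, ?_, ?_, ?_, ?_⟩, ?_, ?_, ?_⟩
    · simpa using hvB
    · rw [Function.update_self, hn']
      exact Finset.erase_subset_erase v hBn
    · simp only [Function.update_self]
      refine hw.imp id fun h => ⟨h.1, ?_⟩
      rw [Function.update_of_ne (hne w h.1)]
      exact h.2
    · exact ht.congr fun x hx => by simp [hne x hx]
    · rw [List.toFinset_cons, hn', Finset.insert_erase hv.1]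
    · intro x hx
      rcases List.mem_cons.1 hx with rfl | hx
      · simpa using hBr
      · simpa [hne x hx] using hb x hx
    · intro e heG
      by_cases hve : v ∈ e
      · exact ⟨v, by simp, hve, by simpa using hBe e heG hve⟩
      · obtain ⟨x, hx, hxe, hxb⟩ := he e (Finset.mem_filter.2
          ⟨Finset.mem_image.2 ⟨e, heG, Finset.erase_eq_of_notMem hve⟩, G.nonempty_edges e heG⟩)
        exact ⟨x, by simp [hx], hxe, by simpa [hne x hx] using hxb⟩

/-! ### Marginals and gluing of local distributions -/

/-- Regard `p` as a distribution on the subsets of `W`. This is the probability that a random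
subset meets `B` exactly in `U`. -/
def marginal (W : Finset α) (p : Finset α → ℝ) (B U : Finset α) : ℝ :=
  ∑ T ∈ W.powerset with T ∩ B = U, p T

theorem marginal_eq_sum_ite (W : Finset α) (p : Finset α → ℝ) (B U : Finset α) :
    marginal W p B U = ∑ T ∈ W.powerset, if T ∩ B = U then p T else 0 :=
  Finset.sum_filter _ _

theorem marginal_congr {W : Finset α} {p q : Finset α → ℝ} (h : ∀ T ⊆ W, p T = q T)
    (B U : Finset α) : marginal W p B U = marginal W q B U :=
  Finset.sum_congr rfl fun T hT => h T (Finset.mem_powerset.1 (Finset.mem_filter.1 hT).1)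

theorem marginal_nonneg {W : Finset α} {p : Finset α → ℝ} (hp : ∀ T ⊆ W, 0 ≤ p T)
    (B U : Finset α) : 0 ≤ marginal W p B U :=
  Finset.sum_nonneg fun T hT => hp T (Finset.mem_powerset.1 (Finset.mem_filter.1 hT).1)

/-- The sum of the marginals over a family of possible intersections. -/
theorem sum_marginal (W : Finset α) (p : Finset α → ℝ) (B : Finset α)
    (s : Finset (Finset α)) :
    ∑ U ∈ s, marginal W p B U = ∑ T ∈ W.powerset with T ∩ B ∈ s, p T := by
  simp_rw [marginal_eq_sum_ite, Finset.sum_filter]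
  rw [Finset.sum_comm]
  exact Finset.sum_congr rfl fun T _ => by simp

theorem sum_powerset_marginal (W : Finset α) (p : Finset α → ℝ) (B : Finset α) :
    ∑ U ∈ B.powerset, marginal W p B U = ∑ T ∈ W.powerset, p T := by
  rw [sum_marginal, Finset.filter_true_of_mem]
  exact fun T _ => Finset.mem_powerset.2 Finset.inter_subset_right

theorem marginal_marginal (W : Finset α) (p : Finset α → ℝ) {B e : Finset α} (he : e ⊆ B)
    (P : Finset α) : marginal B (marginal W p B) e P = marginal W p e P := by
  rw [marginal, sum_marginal, marginal]
  refine Finset.sum_congr (Finset.filter_congr fun T _ => ?_) fun _ _ => rfl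
  simp [Finset.inter_assoc, Finset.inter_eq_right.2 he]

/-- A distribution on the subsets of `W` and one on the subsets of a bag `B` that agree on
`B \ {v}` are the marginals of a distribution on the subsets of `W ∪ {v}`. -/
theorem exists_glue {W B : Finset α} {v : α} (hvW : v ∉ W) (hvB : v ∈ B)
    {p μ : Finset α → ℝ} (hp : ∀ T, 0 ≤ p T) (hμ : ∀ U ⊆ B, 0 ≤ μ U)
    (h : ∀ t ⊆ B.erase v, μ t + μ (insert v t) = marginal W p (B.erase v) t) :
    ∃ q : Finset α → ℝ, (∀ T, 0 ≤ q T) ∧ (∀ T ⊆ W, q T + q (insert v T) = p T) ∧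
      ∀ U ⊆ B, marginal (insert v W) q B U = μ U := by
  set m := marginal W p (B.erase v)
  have hm0 : ∀ t, 0 ≤ m t := marginal_nonneg (fun T _ => hp T) _
  have hnot : ∀ T ⊆ W, v ∉ T := fun T hT hv => hvW (hT hv)
  have e1 : ∀ T ⊆ W, T ∩ B = T ∩ B.erase v := fun T hT => by
    have := hnot T hT
    ext x
    by_cases hx : x = v
    · subst hx; simp [this]
    · simp [hx]
  have e2 : ∀ T ⊆ W, insert v T ∩ B = insert v (T ∩ B.erase v) := fun T hT => by
    rw [Finset.insert_inter_of_mem hvB, e1 T hT]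
  have hq1 : ∀ T ⊆ W, v ∉ T ∩ B.erase v := fun T hT h => hnot T hT (Finset.mem_inter.1 h).1
  -- Conditional independence: draw a subset of `W` from `p`, then decide on `v` by the conditional
  -- law of `μ` given the trace on `B.erase v`.
  let q : Finset α → ℝ := fun T => p (T.erase v) * μ (T ∩ B) / m ((T ∩ B).erase v)
  have q1 : ∀ T ⊆ W, q T = p T * μ (T ∩ B.erase v) / m (T ∩ B.erase v) := fun T hT => by
    simp only [q]
    rw [e1 T hT, Finset.erase_eq_of_notMem (hq1 T hT), Finset.erase_eq_of_notMem (hnot T hT)]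
  have q2 : ∀ T ⊆ W, q (insert v T) =
      p T * μ (insert v (T ∩ B.erase v)) / m (T ∩ B.erase v) := fun T hT => by
    simp only [q]
    rw [e2 T hT, Finset.erase_insert (hq1 T hT), Finset.erase_insert (hnot T hT)]
  refine ⟨q, fun T => div_nonneg (mul_nonneg (hp _) (hμ _ Finset.inter_subset_right)) (hm0 _),
    fun T hT => ?_, fun U hU => ?_⟩
  · rw [q1 T hT, q2 T hT, ← add_div, ← mul_add, h _ Finset.inter_subset_right]
    -- Where the denominator vanishes, so does `p T`, a summand of it; division by zero gives 0, as
    -- needed.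
    by_cases h0 : m (T ∩ B.erase v) = 0
    · have : p T ≤ m (T ∩ B.erase v) :=
        Finset.single_le_sum (f := p) (fun T _ => hp T) (by simpa using hT)
      rw [h0] at this ⊢
      simp [le_antisymm this (hp T)]
    · field_simp
  · have hUe : U.erase v ⊆ B.erase v := Finset.erase_subset_erase v hU
    -- If the denominator is 0, then `μ U` is 0 too, being one of two nonnegative numbers with sum
    -- 0.
    have hz : μ U * (m (U.erase v) / m (U.erase v)) = μ U := by
      by_cases h0 : m (U.erase v) = 0
      · have h1 := h _ hUe
        rw [h0] at h1
        have h2 := hμ _ ((Finset.erase_subset v U).trans hU)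
        have h3 := hμ (insert v (U.erase v)) (Finset.insert_subset hvB
          ((Finset.erase_subset v U).trans hU))
        have : μ U = 0 := by
          by_cases hvU : v ∈ U
          · rw [Finset.insert_erase hvU] at h1 h3
            linarith
          · rw [Finset.erase_eq_of_notMem hvU] at h1 h2 h3
            linarith
        simp [this]
      · rw [div_self h0, mul_one]
    have hsum : ∑ T ∈ W.powerset, (if T ∩ B.erase v = U.erase v then
        p T * μ U / m (U.erase v) else 0) = μ U := by
      rw [← Finset.sum_filter, ← Finset.sum_div, ← Finset.sum_mul]
      change m (U.erase v) * μ U / m (U.erase v) = μ U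
      rw [mul_comm, mul_div_assoc, hz]
    rw [marginal_eq_sum_ite, Finset.sum_powerset_insert hvW]
    by_cases hvU : v ∈ U
    · rw [Finset.sum_eq_zero, zero_add, ← hsum]
      · refine Finset.sum_congr rfl fun T hT => ?_
        have hT := Finset.mem_powerset.1 hT
        have : insert v (T ∩ B.erase v) = U ↔ T ∩ B.erase v = U.erase v := by
          constructor
          · rintro rfl
            rw [Finset.erase_insert (hq1 T hT)]
          · intro h
            rw [h, Finset.insert_erase hvU]
        rw [q2 T hT, e2 T hT]
        by_cases hc : T ∩ B.erase v = U.erase v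
        · rw [if_pos hc, if_pos (this.2 hc), this.2 hc, hc]
        · rw [if_neg hc, if_neg (mt this.1 hc)]
      · intro T hT
        refine if_neg ?_
        rintro rfl
        exact hnot T (Finset.mem_powerset.1 hT) (Finset.mem_inter.1 hvU).1
    · rw [Finset.sum_eq_zero (f := fun T => if insert v T ∩ B = U then q (insert v T) else 0),
        add_zero, ← hsum]
      · refine Finset.sum_congr rfl fun T hT => ?_
        have hT := Finset.mem_powerset.1 hT
        rw [q1 T hT, e1 T hT, Finset.erase_eq_of_notMem hvU]
        by_cases hc : T ∩ B.erase v = U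
        · rw [if_pos hc, if_pos hc, hc]
        · rw [if_neg hc, if_neg hc]
      · intro T hT
        refine if_neg ?_
        rintro rfl
        exact hvU (by simp [hvB])

/-- Local distributions on the bags of an elimination tree that satisfy the consistency
inequalities are the marginals of a distribution on all sets of nodes. -/
theorem IsElimTree.exists_distribution {bag : α → Finset α} {par : α → α}
    {lam : α → Finset α → ℝ} :
    ∀ {l : List α}, IsElimTree bag par l → (∀ v ∈ l, ∀ U ⊆ bag v, 0 ≤ lam v U) →
      (∀ v ∈ l, ∑ U ∈ (bag v).powerset, lam v U ≤ 1) →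
      (∀ v ∈ l, ∀ t ⊆ (bag v).erase v,
        (if bag v = {v} then 1 else marginal (bag (par v)) (lam (par v)) ((bag v).erase v) t) ≤
          marginal (bag v) (lam v) ((bag v).erase v) t) →
      ∃ p : Finset α → ℝ, (∀ T, 0 ≤ p T) ∧ ∑ T ∈ l.toFinset.powerset, p T = 1 ∧
        ∀ v ∈ l, ∀ U ⊆ bag v, marginal l.toFinset p (bag v) U = lam v U
  | [], _, _, _, _ => ⟨fun _ => 1, by simp, by simp, by simp⟩
  | v :: l, ⟨h1, h2, h3, h4, h5⟩, ha, hc, hb => by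
    obtain ⟨p, hp, hp1, hpm⟩ := h5.exists_distribution
      (fun w hw => ha w (by simp [hw])) (fun w hw => hc w (by simp [hw]))
      (fun w hw => hb w (by simp [hw]))
    set W := l.toFinset with hW
    have hvW : v ∉ W := by simpa [hW] using h1
    have hv := List.mem_cons_self (a := v) (l := l)
    have hle : ∀ t ∈ ((bag v).erase v).powerset, marginal W p ((bag v).erase v) t ≤
        marginal (bag v) (lam v) ((bag v).erase v) t := by
      intro t ht
      refine le_trans ?_ (hb v hv t (Finset.mem_powerset.1 ht))
      split_ifs with hs
      -- At a root the only trace is the empty set, and the inequality says that the total mass is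
      -- at least 1.
      · rw [← hp1]
        exact Finset.sum_le_sum_of_subset_of_nonneg (Finset.filter_subset _ _)
          fun T _ _ => hp T
      · obtain ⟨h6, h7⟩ := h4.resolve_left hs
        rw [← marginal_marginal W p h7, marginal_congr (hpm _ h6)]
    -- Summed over `t`, the left sides give 1 and the right sides at most 1, so every inequality is
    -- tight.
    have heq := (Finset.sum_eq_sum_iff_of_le hle).1 (le_antisymm (Finset.sum_le_sum hle) (by
      rw [sum_powerset_marginal, sum_powerset_marginal, hp1]
      exact hc v hv))
    obtain ⟨q, hq, hq1, hq2⟩ := exists_glue hvW h2 hp (ha v hv) (fun t ht => by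
      rw [heq t (Finset.mem_powerset.2 ht), marginal]
      have hvt : v ∉ t := fun h => by simpa using ht h
      have : ({T ∈ (bag v).powerset | T ∩ (bag v).erase v = t} : Finset (Finset α)) =
          {t, insert v t} := by
        ext T
        simp only [Finset.mem_filter, Finset.mem_powerset, Finset.mem_insert,
          Finset.mem_singleton]
        have htB := ht.trans (Finset.erase_subset _ _)
        constructor
        · rintro ⟨hT, rfl⟩
          rw [← Finset.erase_inter_comm, Finset.inter_eq_left.2
            ((Finset.erase_subset _ _).trans hT)]
          by_cases hvT : v ∈ T
          · right; rw [Finset.insert_erase hvT]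
          · left; rw [Finset.erase_eq_of_notMem hvT]
        · rintro (rfl | rfl)
          · exact ⟨htB, Finset.inter_eq_left.2 ht⟩
          · refine ⟨Finset.insert_subset h2 htB, ?_⟩
            rw [Finset.insert_inter_of_notMem (by simp), Finset.inter_eq_left.2 ht]
      rw [this, Finset.sum_pair]
      exact fun h => hvt (h ▸ Finset.mem_insert_self v t))
    rw [List.toFinset_cons]
    refine ⟨q, hq, ?_, fun w hw U hU => ?_⟩
    · rw [Finset.sum_powerset_insert hvW, ← Finset.sum_add_distrib, ← hp1]
      exact Finset.sum_congr rfl fun T hT => hq1 T (Finset.mem_powerset.1 hT)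
    · rcases List.mem_cons.1 hw with rfl | hw
      · exact hq2 U hU
      · rw [← hpm w hw U hU, marginal_eq_sum_ite, Finset.sum_powerset_insert hvW,
          ← Finset.sum_add_distrib, marginal_eq_sum_ite]
        refine Finset.sum_congr rfl fun T hT => ?_
        have hvb : v ∉ bag w := fun h => hvW (h5.bag_subset w hw h)
        rw [Finset.insert_inter_of_notMem hvb]
        split_ifs
        · exact hq1 T (Finset.mem_powerset.1 hT)
        · simp

end FinHypergraph

/-! ### Linear systems with arbitrary finite index types -/

theorem LinearSystem.exists_of_matrix {ι : Type u} [Fintype ι] {J K : Type*} [Fintype J]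
    [Fintype K] (A : Matrix K (ι ⊕ J) ℝ) (b : K → ℝ)
    (hA : ∀ i j, A i j = 0 ∨ A i j = 1 ∨ A i j = -1) (hb : ∀ i, b i = 0 ∨ b i = 1 ∨ b i = -1) :
    ∃ L : LinearSystem ι, L.HasZeroOneNegOneData ∧ L.numVars = Fintype.card ι + Fintype.card J ∧
      L.numIneqs = Fintype.card K ∧
      L.IsExtendedFormulationOf {z | ∃ y : J → ℝ, A.mulVec (Sum.elim z y) ≤ b} := by
  let f := Fintype.equivFin J
  let g := Fintype.equivFin K
  refine ⟨⟨Fintype.card J, Fintype.card K,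
    A.submatrix g.symm (Sum.map id f.symm), b ∘ g.symm⟩, ⟨fun _ _ => hA _ _, fun _ => hb _⟩,
    rfl, rfl, ?_⟩
  have key : ∀ (z : ι → ℝ) (y : J → ℝ),
      (A.submatrix g.symm (Sum.map id f.symm)).mulVec (Sum.elim z (y ∘ f.symm)) ≤ b ∘ g.symm ↔
        A.mulVec (Sum.elim z y) ≤ b := by
    intro z y
    have : (A.submatrix g.symm (Sum.map id f.symm)).mulVec (Sum.elim z (y ∘ f.symm)) =
        A.mulVec (Sum.elim z y) ∘ g.symm := by
      ext k
      simp only [Matrix.mulVec, dotProduct, Fintype.sum_sum_type, Matrix.submatrix_apply,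
        Sum.map_inl, Sum.map_inr, Sum.elim_inl, Sum.elim_inr, Function.comp_apply, id]
      congr 1
      exact Equiv.sum_comp f.symm fun j => A (g.symm k) (Sum.inr j) * y j
    rw [this]
    refine ⟨fun h k => ?_, fun h k => h _⟩
    simpa using h (g k)
  ext z
  constructor
  · rintro ⟨y, hy⟩
    refine ⟨y ∘ f, (key z (y ∘ f)).1 ?_⟩
    simpa [Function.comp_assoc] using hy
  · rintro ⟨y, hy⟩
    exact ⟨y ∘ f.symm, (key z y).2 hy⟩

/-! ### Pattern polytopes and the inequalities that describe them -/

namespace FinHypergraph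

variable {α : Type u} [DecidableEq α] {ι : Type u}

/-- The vector with an entry `1` for those patterns `P c ⊆ e c` that `T` has on `e c`. -/
def patternVector (e P : ι → Finset α) (T : Finset α) : ι → ℝ :=
  fun c => if T ∩ e c = P c then 1 else 0

theorem sum_mul_patternVector (W : Finset α) (p : Finset α → ℝ) (e P : ι → Finset α) (c : ι) :
    ∑ T ∈ W.powerset, p T * patternVector e P T c = marginal W p (e c) (P c) := by
  simp [patternVector, marginal_eq_sum_ite]

theorem convexHull_patternVector (W : Finset α) (e P : ι → Finset α) :
    convexHull ℝ (patternVector e P '' {T | T ⊆ W}) =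
      {z | ∃ p : Finset α → ℝ, (∀ T, 0 ≤ p T) ∧ ∑ T ∈ W.powerset, p T = 1 ∧
        ∀ c, z c = marginal W p (e c) (P c)} := by
  apply Set.Subset.antisymm
  · apply convexHull_min
    · rintro _ ⟨T, hT, rfl⟩
      have hT : T ∈ W.powerset := Finset.mem_powerset.2 hT
      refine ⟨fun S => if S = T then 1 else 0, fun S => by positivity, ?_, fun c => ?_⟩
      · simpa using hT
      · rw [← sum_mul_patternVector]
        simp only [ite_mul, one_mul, zero_mul, Finset.sum_ite_eq', if_pos hT]
    · rintro z ⟨p, hp, hp1, hpz⟩ w ⟨q, hq, hq1, hqw⟩ s t hs ht hst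
      refine ⟨fun T => s * p T + t * q T, fun T => ?_, ?_, fun c => ?_⟩
      · have := hp T
        have := hq T
        positivity
      · rw [Finset.sum_add_distrib, ← Finset.mul_sum, ← Finset.mul_sum, hp1, hq1]
        simpa using hst
      · simp [hpz, hqw, marginal, Finset.sum_add_distrib, Finset.mul_sum]
  · rintro z ⟨p, hp, hp1, hpz⟩
    have hz : z = ∑ T ∈ W.powerset, p T • patternVector e P T := by
      ext c
      simp [hpz, Finset.sum_apply, sum_mul_patternVector]
    rw [hz]
    exact (convex_convexHull ℝ _).sum_mem (fun T _ => hp T) hp1 fun T hT =>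
      subset_convexHull ℝ _ ⟨T, Finset.mem_powerset.1 hT, rfl⟩

variable [Fintype ι]

/-- The patterns that are prescribed on the set `f`. -/
def patternsOn (e P : ι → Finset α) (f : Finset α) : Finset (Finset α) :=
  (Finset.univ.filter fun c => e c = f).image P

/-- The inequalities of the extended formulation, where `lam v` is the local distribution on the
subsets of `bag v`. -/
structure IsFeasible (l : List α) (bag : α → Finset α) (par : α → α) (e P : ι → Finset α)
    (home : Finset α → α) (z : ι → ℝ) (lam : α → Finset α → ℝ) : Prop where
  nonneg : ∀ v ∈ l, ∀ U ⊆ bag v, 0 ≤ lam v U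
  consistent : ∀ v ∈ l, ∀ t ⊆ (bag v).erase v,
    (if bag v = {v} then 1 else marginal (bag (par v)) (lam (par v)) ((bag v).erase v) t) ≤
      marginal (bag v) (lam v) ((bag v).erase v) t
  sum_le_one : ∀ v ∈ l, ∑ U ∈ (bag v).powerset, lam v U ≤ 1
  le_coord : ∀ c, marginal (bag (home (e c))) (lam (home (e c))) (e c) (P c) ≤ z c
  sum_coord_le : ∀ f ∈ Finset.univ.image e, ∑ c with e c = f, z c ≤
    ∑ U ∈ (bag (home f)).powerset with U ∩ f ∈ patternsOn e P f, lam (home f) U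

/-- Coordinates with the same support have distinct patterns, so the sum in `sum_coord_le` is
exactly the sum of their marginals. With the lower bounds `le_coord` this makes each coordinate
equal to its marginal. Conversely, the marginals of a global distribution satisfy all inequalities
with equality, apart from nonnegativity. -/
theorem IsElimTree.exists_isFeasible_iff {l : List α} {bag : α → Finset α} {par : α → α}
    (ht : IsElimTree bag par l) {e P : ι → Finset α}
    (inj : Function.Injective fun c => (e c, P c)) {home : Finset α → α}
    (hh : ∀ c, home (e c) ∈ l ∧ home (e c) ∈ e c ∧ e c ⊆ bag (home (e c))) (z : ι → ℝ) :
    (∃ lam, IsFeasible l bag par e P home z lam) ↔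
      ∃ p : Finset α → ℝ, (∀ T, 0 ≤ p T) ∧ ∑ T ∈ l.toFinset.powerset, p T = 1 ∧
        ∀ c, z c = marginal l.toFinset p (e c) (P c) := by
  have hsum : ∀ (p : Finset α → ℝ), ∀ f ∈ Finset.univ.image e,
      ∑ U ∈ (bag (home f)).powerset with U ∩ f ∈ patternsOn e P f,
        marginal l.toFinset p (bag (home f)) U =
      ∑ c with e c = f, marginal l.toFinset p (e c) (P c) := by
    intro p f hf
    obtain ⟨c, -, rfl⟩ := Finset.mem_image.1 hf
    rw [← sum_marginal]
    simp_rw [marginal_marginal _ _ (hh c).2.2]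
    rw [patternsOn, Finset.sum_image]
    · exact Finset.sum_congr rfl fun d hd => by rw [(Finset.mem_filter.1 hd).2]
    · intro d hd d' hd' hdd
      rw [Finset.mem_coe, Finset.mem_filter] at hd hd'
      exact inj (Prod.ext (hd.2.trans hd'.2.symm) hdd)
  constructor
  · rintro ⟨lam, h⟩
    obtain ⟨p, hp, hp1, hpm⟩ := ht.exists_distribution h.nonneg h.sum_le_one h.consistent
    refine ⟨p, hp, hp1, ?_⟩
    have hle : ∀ c, marginal l.toFinset p (e c) (P c) ≤ z c := fun c => by
      rw [← marginal_marginal _ p (hh c).2.2, marginal_congr (hpm _ (hh c).1)]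
      exact h.le_coord c
    intro c
    have hc : e c ∈ Finset.univ.image e := Finset.mem_image_of_mem _ (Finset.mem_univ c)
    have hge := h.sum_coord_le _ hc
    rw [← Finset.sum_congr rfl fun U hU => hpm _ (hh c).1 U
      (Finset.mem_powerset.1 (Finset.mem_filter.1 hU).1), hsum p _ hc] at hge
    exact ((Finset.sum_eq_sum_iff_of_le fun d _ => hle d).1
      (le_antisymm (Finset.sum_le_sum fun d _ => hle d) hge) c (by simp)).symm
  · rintro ⟨p, hp, hp1, hz⟩
    refine ⟨fun v => marginal l.toFinset p (bag v),
      fun v _ U _ => marginal_nonneg (fun T _ => hp T) _ _, fun v hv t htv => ?_,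
      fun v _ => by rw [sum_powerset_marginal, hp1], fun c => ?_, fun f hf => ?_⟩
    · rw [marginal_marginal _ _ (Finset.erase_subset _ _)]
      split_ifs with hs
      · rw [hs, Finset.erase_singleton, Finset.subset_empty] at htv
        rw [htv, hs, Finset.erase_singleton, ← hp1, marginal]
        simp
      · rw [marginal_marginal _ _ (ht.par_spec v hv hs).2.2]
    · rw [marginal_marginal _ _ (hh c).2.2, hz]
    · rw [hsum p f hf, Finset.sum_congr rfl fun c _ => hz c]

/-! ### The system in matrix form -/

/-- The index set of the variables `lam v U`. -/
abbrev AuxIndex (l : List α) (bag : α → Finset α) : Type u :=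
  {x : Σ _ : α, Finset α // x ∈ l.toFinset.sigma fun v => (bag v).powerset}

/-- The index set of the inequalities. -/
abbrev IneqIndex (l : List α) (bag : α → Finset α) (e : ι → Finset α) : Type u :=
  AuxIndex l bag ⊕ {x : Σ _ : α, Finset α // x ∈ l.toFinset.sigma fun v =>
    ((bag v).erase v).powerset} ⊕ l.toFinset ⊕ ι ⊕ (Finset.univ.image e : Finset (Finset α))

/-- The coefficient vector of a sum of variables `lam v U` with a fixed node `v`. -/
def auxIndicator {l : List α} {bag : α → Finset α} (v : α) (Q : Finset α → Prop)
    [DecidablePred Q] (j : AuxIndex l bag) : ℝ :=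
  if j.1.1 = v ∧ Q j.1.2 then 1 else 0

theorem sum_auxIndicator_mul {l : List α} {bag : α → Finset α} {v : α} (hv : v ∈ l)
    (Q : Finset α → Prop) [DecidablePred Q] (lam : α → Finset α → ℝ) :
    ∑ j : AuxIndex l bag, auxIndicator v Q j * lam j.1.1 j.1.2 =
      ∑ U ∈ (bag v).powerset with Q U, lam v U := by
  simp only [auxIndicator]
  rw [Finset.sum_coe_sort (l.toFinset.sigma fun v => (bag v).powerset)
    fun x => (if x.1 = v ∧ Q x.2 then 1 else 0) * lam x.1 x.2, Finset.sum_sigma,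
    Finset.sum_eq_single v]
  · rw [Finset.sum_filter]
    exact Finset.sum_congr rfl fun U _ => by simp
  · intro w _ hw
    exact Finset.sum_eq_zero fun U _ => by simp [hw]
  · intro h
    exact absurd (List.mem_toFinset.2 hv) h

open Classical in
/-- The matrix of the inequalities. -/
noncomputable def ineqMatrix (l : List α) (bag : α → Finset α) (par : α → α)
    (e P : ι → Finset α) (home : Finset α → α) :
    Matrix (IneqIndex l bag e) (ι ⊕ AuxIndex l bag) ℝ
  | .inl i, .inr j => -auxIndicator i.1.1 (· = i.1.2) j
  | .inr (.inl i), .inr j =>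
      (if bag i.1.1 = {i.1.1} then 0
        else auxIndicator (par i.1.1) (· ∩ (bag i.1.1).erase i.1.1 = i.1.2) j) -
      auxIndicator i.1.1 (· ∩ (bag i.1.1).erase i.1.1 = i.1.2) j
  | .inr (.inr (.inl v)), .inr j => auxIndicator v.1 (fun _ => True) j
  | .inr (.inr (.inr (.inl c))), .inl d => if d = c then -1 else 0
  | .inr (.inr (.inr (.inl c))), .inr j => auxIndicator (home (e c)) (· ∩ e c = P c) j
  | .inr (.inr (.inr (.inr f))), .inl d => if e d = f.1 then 1 else 0
  | .inr (.inr (.inr (.inr f))), .inr j =>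
      -auxIndicator (home f.1) (· ∩ f.1 ∈ patternsOn e P f.1) j
  | _, .inl _ => 0

/-- The right-hand sides of the inequalities. -/
def ineqRhs (l : List α) (bag : α → Finset α) (e : ι → Finset α) : IneqIndex l bag e → ℝ
  | .inr (.inl i) => if bag i.1.1 = {i.1.1} then -1 else 0
  | .inr (.inr (.inl _)) => 1
  | _ => 0

theorem auxIndicator_eq_or {l : List α} {bag : α → Finset α} (v : α) (Q : Finset α → Prop)
    [DecidablePred Q] (j : AuxIndex l bag) : auxIndicator v Q j = 0 ∨ auxIndicator v Q j = 1 := by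
  unfold auxIndicator
  split_ifs <;> simp

theorem IsElimTree.ineqMatrix_eq_or {l : List α} {bag : α → Finset α} {par : α → α}
    (ht : IsElimTree bag par l) (e P : ι → Finset α) (home : Finset α → α)
    (i : IneqIndex l bag e) (j : ι ⊕ AuxIndex l bag) :
    ineqMatrix l bag par e P home i j = 0 ∨ ineqMatrix l bag par e P home i j = 1 ∨
      ineqMatrix l bag par e P home i j = -1 := by
  rcases i with i | i | v | c | f <;> rcases j with d | j <;> simp only [ineqMatrix]
  · simp
  · rcases auxIndicator_eq_or i.1.1 (· = i.1.2) j with h | h <;> simp [h]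
  · simp
  · have hi : i.1.1 ∈ l := List.mem_toFinset.1 (Finset.mem_sigma.1 i.2).1
    by_cases hs : bag i.1.1 = {i.1.1}
    · rw [if_pos hs]
      rcases auxIndicator_eq_or i.1.1 (· ∩ (bag i.1.1).erase i.1.1 = i.1.2) j with h | h <;>
        simp [h]
    · have := (ht.par_spec _ hi hs).2.1
      rw [if_neg hs]
      unfold auxIndicator
      by_cases h1 : j.1.1 = i.1.1
      · rw [if_neg (fun h => this (h.1.symm.trans h1))]
        split_ifs <;> simp
      · rw [if_neg (fun h => h1 h.1) (c := j.1.1 = i.1.1 ∧ _)]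
        split_ifs <;> simp
  · simp
  · rcases auxIndicator_eq_or v.1 (fun _ => True) j with h | h <;> simp [h]
  · split_ifs <;> simp
  · rcases auxIndicator_eq_or (home (e c)) (· ∩ e c = P c) j with h | h <;> simp [h]
  · split_ifs <;> simp
  · rcases auxIndicator_eq_or (home f.1) (· ∩ f.1 ∈ patternsOn e P f.1) j with h | h <;> simp [h]

theorem ineqRhs_eq_or (l : List α) (bag : α → Finset α) (e : ι → Finset α)
    (i : IneqIndex l bag e) :
    ineqRhs l bag e i = 0 ∨ ineqRhs l bag e i = 1 ∨ ineqRhs l bag e i = -1 := by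
  rcases i with i | i | v | c | f <;> simp only [ineqRhs]
  · simp
  · split_ifs <;> simp
  · simp
  · simp
  · simp

theorem IsElimTree.ineqMatrix_mulVec_le_iff {l : List α} {bag : α → Finset α} {par : α → α}
    (ht : IsElimTree bag par l) {e : ι → Finset α} (P : ι → Finset α) {home : Finset α → α}
    (hh : ∀ c, home (e c) ∈ l) (z : ι → ℝ) (lam : α → Finset α → ℝ) :
    (ineqMatrix l bag par e P home).mulVec (Sum.elim z fun j => lam j.1.1 j.1.2) ≤
      ineqRhs l bag e ↔ IsFeasible l bag par e P home z lam := by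
  classical
  have row1 : ∀ i, (ineqMatrix l bag par e P home).mulVec
      (Sum.elim z fun j => lam j.1.1 j.1.2) (.inl i) = -lam i.1.1 i.1.2 := fun i => by
    have hi := Finset.mem_sigma.1 i.2
    simp only [Matrix.mulVec, dotProduct, Fintype.sum_sum_type, ineqMatrix, Sum.elim_inr,
      zero_mul, neg_mul, Finset.sum_const_zero, zero_add, Finset.sum_neg_distrib]
    rw [sum_auxIndicator_mul (List.mem_toFinset.1 hi.1), Finset.filter_eq', if_pos hi.2,
      Finset.sum_singleton]
  have row2 : ∀ i, (ineqMatrix l bag par e P home).mulVec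
      (Sum.elim z fun j => lam j.1.1 j.1.2) (.inr (.inl i)) =
      (if bag i.1.1 = {i.1.1} then 0 else marginal (bag (par i.1.1)) (lam (par i.1.1))
        ((bag i.1.1).erase i.1.1) i.1.2) -
      marginal (bag i.1.1) (lam i.1.1) ((bag i.1.1).erase i.1.1) i.1.2 := fun i => by
    have hi := List.mem_toFinset.1 (Finset.mem_sigma.1 i.2).1
    simp only [Matrix.mulVec, dotProduct, Fintype.sum_sum_type, ineqMatrix, Sum.elim_inr,
      zero_mul, Finset.sum_const_zero, zero_add, sub_mul, Finset.sum_sub_distrib]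
    rw [sum_auxIndicator_mul hi]
    congr 1
    split_ifs with hs
    · simp
    · exact sum_auxIndicator_mul (ht.par_spec _ hi hs).1 _ _
  have row3 : ∀ v, (ineqMatrix l bag par e P home).mulVec
      (Sum.elim z fun j => lam j.1.1 j.1.2) (.inr (.inr (.inl v))) =
      ∑ U ∈ (bag v).powerset, lam v U := fun v => by
    simp only [Matrix.mulVec, dotProduct, Fintype.sum_sum_type, ineqMatrix, Sum.elim_inr,
      zero_mul, Finset.sum_const_zero, zero_add]
    rw [sum_auxIndicator_mul (List.mem_toFinset.1 v.2), Finset.filter_true]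
  have row4 : ∀ c, (ineqMatrix l bag par e P home).mulVec
      (Sum.elim z fun j => lam j.1.1 j.1.2) (.inr (.inr (.inr (.inl c)))) =
      -z c + marginal (bag (home (e c))) (lam (home (e c))) (e c) (P c) := fun c => by
    simp only [Matrix.mulVec, dotProduct, Fintype.sum_sum_type, ineqMatrix, Sum.elim_inl,
      Sum.elim_inr]
    rw [sum_auxIndicator_mul (hh c), marginal]
    simp
  have row5 : ∀ f, (ineqMatrix l bag par e P home).mulVec
      (Sum.elim z fun j => lam j.1.1 j.1.2) (.inr (.inr (.inr (.inr f)))) =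
      ∑ c with e c = f.1, z c - ∑ U ∈ (bag (home f.1)).powerset with
        U ∩ f.1 ∈ patternsOn e P f.1, lam (home f.1) U := fun f => by
    obtain ⟨c, -, hc⟩ := Finset.mem_image.1 f.2
    simp only [Matrix.mulVec, dotProduct, Fintype.sum_sum_type, ineqMatrix, Sum.elim_inl,
      Sum.elim_inr, neg_mul, Finset.sum_neg_distrib]
    rw [sum_auxIndicator_mul (hc ▸ hh c), Finset.sum_filter (fun c => e c = f.1), sub_eq_add_neg]
    simp
  constructor
  · refine fun h => ⟨fun v hv U hU => ?_, fun v hv t htv => ?_, fun v hv => ?_, fun c => ?_,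
      fun f hf => ?_⟩
    · have := h (.inl ⟨⟨v, U⟩, by simpa using ⟨hv, hU⟩⟩)
      rw [row1] at this
      simpa [ineqRhs] using this
    · have := h (.inr (.inl ⟨⟨v, t⟩, Finset.mem_sigma.2 ⟨List.mem_toFinset.2 hv,
        Finset.mem_powerset.2 htv⟩⟩))
      rw [row2] at this
      simp only [ineqRhs] at this
      split_ifs at this ⊢ <;> linarith
    · have := h (.inr (.inr (.inl ⟨v, List.mem_toFinset.2 hv⟩)))
      rwa [row3] at this
    · have := h (.inr (.inr (.inr (.inl c))))
      rw [row4] at this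
      simp only [ineqRhs] at this
      linarith
    · have := h (.inr (.inr (.inr (.inr ⟨f, hf⟩))))
      rw [row5] at this
      simp only [ineqRhs] at this
      linarith
  · rintro h (i | i | v | c | f)
    · rw [row1]
      have hi := Finset.mem_sigma.1 i.2
      simpa [ineqRhs] using
        h.nonneg _ (List.mem_toFinset.1 hi.1) _ (Finset.mem_powerset.1 hi.2)
    · rw [row2]
      have hi := Finset.mem_sigma.1 i.2
      have := h.consistent _ (List.mem_toFinset.1 hi.1) _ (Finset.mem_powerset.1 hi.2)
      simp only [ineqRhs]
      split_ifs at this ⊢ <;> linarith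
    · rw [row3]
      exact h.sum_le_one _ (List.mem_toFinset.1 v.2)
    · rw [row4]
      simp only [ineqRhs]
      linarith [h.le_coord c]
    · rw [row5]
      simp only [ineqRhs]
      linarith [h.sum_coord_le f.1 f.2]

/-! ### Counting variables and inequalities -/

/-- The sum counts pairs `P ⊆ e ⊆ B` with `v ∈ e`: any other node of `B` is outside `e`, in `e \ P`
or in `P`, while `v` has only the last two options. -/
theorem sum_two_pow_card_of_mem {B : Finset α} {v : α} (hv : v ∈ B) :
    ∑ e ∈ B.powerset with v ∈ e, 2 ^ e.card = 2 * 3 ^ (B.card - 1) := by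
  obtain ⟨s, hvs, rfl⟩ : ∃ s, v ∉ s ∧ B = insert v s :=
    ⟨B.erase v, by simp, (Finset.insert_erase hv).symm⟩
  rw [Finset.sum_filter, Finset.sum_powerset_insert hvs, Finset.sum_eq_zero, zero_add,
    Finset.card_insert_of_notMem hvs, Nat.add_sub_cancel]
  · have := Finset.sum_pow_mul_eq_add_pow 2 1 s
    rw [show (3 : ℕ) = 2 + 1 from rfl, ← this, Finset.mul_sum]
    refine Finset.sum_congr rfl fun t ht => ?_
    rw [if_pos (Finset.mem_insert_self v t), Finset.card_insert_of_notMem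
      fun h => hvs (Finset.mem_powerset.1 ht h)]
    simp [pow_succ, mul_comm]
  · exact fun t ht => if_neg fun h => hvs (Finset.mem_powerset.1 ht h)

section Counting

variable {l : List α} {bag : α → Finset α} {par : α → α} {r : ℕ}

/-- A coordinate is determined by its support and pattern, and these are among the pairs counted by
`sum_two_pow_card_of_mem` for its home. This is the source of the term `(2/3) 3 ^ r`, and it covers
node coordinates as well as signed edges. -/
theorem card_le_of_home (hb : ∀ v ∈ l, (bag v).card ≤ r) {e P : ι → Finset α}
    (inj : Function.Injective fun c => (e c, P c)) (hP : ∀ c, P c ⊆ e c) {home : Finset α → α}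
    (hh : ∀ c, home (e c) ∈ l ∧ home (e c) ∈ e c ∧ e c ⊆ bag (home (e c))) :
    Fintype.card ι ≤ l.length * (2 * 3 ^ (r - 1)) := by
  let t : Finset (Σ _ : α, Σ _ : Finset α, Finset α) := l.toFinset.sigma fun v =>
    ((bag v).powerset.filter (v ∈ ·)).sigma fun f => f.powerset
  have h1 : Fintype.card ι ≤ t.card := by
    rw [← Finset.card_univ]
    refine Finset.card_le_card_of_injOn (fun c => ⟨home (e c), e c, P c⟩) (fun c _ => ?_)
      fun c _ d _ hcd => ?_
    · simpa [t, hh c] using hP c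
    · apply inj
      simp only [Sigma.mk.injEq, heq_eq_eq] at hcd
      exact Prod.ext hcd.2.1 hcd.2.2
  refine h1.trans ?_
  rw [Finset.card_sigma]
  refine (Finset.sum_le_card_nsmul _ _ (2 * 3 ^ (r - 1)) fun v hv => ?_).trans ?_
  · rw [Finset.card_sigma]
    simp_rw [Finset.card_powerset]
    by_cases hvb : v ∈ bag v
    · rw [sum_two_pow_card_of_mem hvb]
      gcongr
      · simp
      · exact hb v (List.mem_toFinset.1 hv)
    · rw [Finset.sum_eq_zero]
      · exact Nat.zero_le _
      · intro f hf
        rw [Finset.mem_filter, Finset.mem_powerset] at hf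
        exact absurd (hf.1 hf.2) hvb
  · rw [smul_eq_mul]
    exact Nat.mul_le_mul_right _ (List.toFinset_card_le l)

theorem card_auxIndex_le (hb : ∀ v ∈ l, (bag v).card ≤ r) :
    Fintype.card (AuxIndex l bag) ≤ l.length * 2 ^ r := by
  rw [Fintype.card_coe, Finset.card_sigma]
  refine (Finset.sum_le_card_nsmul _ _ (2 ^ r) fun v hv => ?_).trans ?_
  · rw [Finset.card_powerset]
    exact Nat.pow_le_pow_right (by norm_num) (hb v (List.mem_toFinset.1 hv))
  · rw [smul_eq_mul]
    exact Nat.mul_le_mul_right _ (List.toFinset_card_le l)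

theorem IsElimTree.card_sigma_erase_le (ht : IsElimTree bag par l)
    (hb : ∀ v ∈ l, (bag v).card ≤ r) :
    (l.toFinset.sigma fun v => ((bag v).erase v).powerset).card ≤ l.length * 2 ^ (r - 1) := by
  rw [Finset.card_sigma]
  refine (Finset.sum_le_card_nsmul _ _ (2 ^ (r - 1)) fun v hv => ?_).trans ?_
  · have hv := List.mem_toFinset.1 hv
    rw [Finset.card_powerset, Finset.card_erase_of_mem (ht.mem_bag v hv)]
    exact Nat.pow_le_pow_right (by norm_num) (Nat.sub_le_sub_right (hb v hv) 1)
  · rw [smul_eq_mul]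
    exact Nat.mul_le_mul_right _ (List.toFinset_card_le l)

/-- A support `f` is recovered from its home and `f.erase (home f)`, since the home belongs to `f`.
-/
theorem card_image_le_of_home {e : ι → Finset α} {home : Finset α → α}
    (hh : ∀ c, home (e c) ∈ l ∧ home (e c) ∈ e c ∧ e c ⊆ bag (home (e c))) :
    (Finset.univ.image e).card ≤
      (l.toFinset.sigma fun v => ((bag v).erase v).powerset).card := by
  have hh' : ∀ f ∈ Finset.univ.image e, home f ∈ l ∧ home f ∈ f ∧ f ⊆ bag (home f) := by
    intro f hf
    obtain ⟨c, -, rfl⟩ := Finset.mem_image.1 hf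
    exact hh c
  refine Finset.card_le_card_of_injOn (fun f => ⟨home f, f.erase (home f)⟩) (fun f hf => ?_)
    fun f hf g hg hfg => ?_
  · obtain ⟨h1, -, h3⟩ := hh' f hf
    exact Finset.mem_sigma.2 ⟨List.mem_toFinset.2 h1,
      Finset.mem_powerset.2 (Finset.erase_subset_erase _ h3)⟩
  · simp only [Sigma.mk.injEq, heq_eq_eq] at hfg
    rw [← Finset.insert_erase (hh' f hf).2.1, ← Finset.insert_erase (hh' g hg).2.1, hfg.2, hfg.1]

/-- Per node: `2 ^ r` for nonnegativity, `2 ^ (r - 1)` for consistency, 1 for the total mass, `2 * 3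
^ (r - 1)` for the coordinates and `2 ^ (r - 1)` for the distinct supports. -/
theorem IsElimTree.card_ineqIndex_le (ht : IsElimTree bag par l) (hr : 1 ≤ r)
    (hb : ∀ v ∈ l, (bag v).card ≤ r) {e P : ι → Finset α}
    (inj : Function.Injective fun c => (e c, P c)) (hP : ∀ c, P c ⊆ e c) {home : Finset α → α}
    (hh : ∀ c, home (e c) ∈ l ∧ home (e c) ∈ e c ∧ e c ⊆ bag (home (e c))) :
    Fintype.card (IneqIndex l bag e) ≤ l.length * (2 * 3 ^ (r - 1) + 2 * 2 ^ r + 1) := by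
  have h1 := card_auxIndex_le hb
  have h2 := ht.card_sigma_erase_le hb
  have h3 := List.toFinset_card_le l
  have h4 := card_le_of_home hb inj hP hh
  have h5 := card_image_le_of_home hh
  rw [Fintype.card_coe] at h1
  simp only [Fintype.card_sum, Fintype.card_coe]
  obtain ⟨k, rfl⟩ := Nat.exists_eq_add_of_le hr
  have : 2 ^ (1 + k) = 2 * 2 ^ k := by rw [pow_add, pow_one]
  simp only [Nat.add_sub_cancel_left] at *
  rw [this] at h1 ⊢
  linarith

end Counting

/-! ### The extended formulation of a pattern polytope -/

/-- The convex hull of the pattern vectors has a small extended formulation if every pattern lives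
in a bag of an elimination tree. -/
theorem IsElimTree.exists_extendedFormulation [Nonempty α] {l : List α} {bag : α → Finset α} {par : α → α}
    (ht : IsElimTree bag par l) {r : ℕ} (hr : 1 ≤ r) (hb : ∀ v ∈ l, (bag v).card ≤ r)
    {e P : ι → Finset α} (inj : Function.Injective fun c => (e c, P c)) (hP : ∀ c, P c ⊆ e c)
    (hh : ∀ c, ∃ v ∈ l, v ∈ e c ∧ e c ⊆ bag v) :
    ∃ L : LinearSystem ι,
      L.IsExtendedFormulationOf (convexHull ℝ (patternVector e P '' {T | T ⊆ l.toFinset})) ∧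
      L.HasZeroOneNegOneData ∧ L.numVars ≤ l.length * (2 * 3 ^ (r - 1) + 2 ^ r) ∧
      L.numIneqs ≤ l.length * (2 * 3 ^ (r - 1) + 2 * 2 ^ r + 1) := by
  classical
  -- The home depends on the support alone, so that all coordinates with the same support read the
  -- same local distribution.
  have hhome : ∃ home : Finset α → α,
      ∀ c, home (e c) ∈ l ∧ home (e c) ∈ e c ∧ e c ⊆ bag (home (e c)) :=
    ⟨fun f => Classical.epsilon fun v => v ∈ l ∧ v ∈ f ∧ f ⊆ bag v,
      fun c => Classical.epsilon_spec (hh c)⟩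
  obtain ⟨home, hh⟩ := hhome
  obtain ⟨L, hL, hv, hi, hext⟩ := LinearSystem.exists_of_matrix (ineqMatrix l bag par e P home)
    (ineqRhs l bag e) (ht.ineqMatrix_eq_or e P home) (ineqRhs_eq_or l bag e)
  refine ⟨L, ?_, hL, ?_, hi.trans_le (ht.card_ineqIndex_le hr hb inj hP hh)⟩
  · convert hext
    rw [convexHull_patternVector]
    ext z
    rw [Set.mem_ofPred_eq, Set.mem_ofPred_eq, ← ht.exists_isFeasible_iff inj hh]
    simp_rw [← ht.ineqMatrix_mulVec_le_iff P (fun c => (hh c).1)]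
    constructor
    · rintro ⟨lam, h⟩
      exact ⟨_, h⟩
    · rintro ⟨y, h⟩
      -- Values outside the bags do not enter the system; 0 is a filler.
      refine ⟨fun v U => if hx : ⟨v, U⟩ ∈ l.toFinset.sigma fun v => (bag v).powerset
        then y ⟨_, hx⟩ else 0, ?_⟩
      convert h using 4 with j
      exact dif_pos j.2
  · rw [hv, mul_add]
    exact Nat.add_le_add (card_le_of_home hb inj hP hh) (card_auxIndex_le hb)

end FinHypergraph

/-! ### Pseudo-Boolean polytopes as pattern polytopes -/

namespace SignedHypergraph

open FinHypergraph

variable {α : Type u} (H : SignedHypergraph α)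

/-- The set of nodes on which a coordinate depends. -/
def support : H.Coord → Finset α :=
  Sum.elim (fun v => {v.1}) fun s => s.1.1

/-- The set of nodes of the support of a coordinate that have to be `1`. -/
def positives : H.Coord → Finset α :=
  Sum.elim (fun v => {v.1}) fun s =>
    (Finset.univ.filter fun v => s.1.2 v = 1).map (Function.Embedding.subtype (· ∈ s.1.1))

theorem positives_subset_support (c : H.Coord) : H.positives c ⊆ H.support c := by
  rcases c with v | s
  · exact subset_rfl
  · intro x hx
    obtain ⟨y, -, rfl⟩ := Finset.mem_map.1 hx
    exact y.2

theorem mem_positives_inr (s : H.edges) (v : s.1.1) :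
    v.1 ∈ H.positives (Sum.inr s) ↔ s.1.2 v = 1 := by
  simp [positives]

/-- Node coordinates have singleton supports and edges at least two nodes, so the two kinds never
collide; for parallel edges the positive nodes determine the signs. -/
theorem support_positives_injective :
    Function.Injective fun c => (H.support c, H.positives c) := by
  have hcard : ∀ (v : H.nodes) (s : H.edges),
      H.support (Sum.inl v) ≠ H.support (Sum.inr s) := by
    intro v s h
    have h1 := H.two_le_card s.1 s.2
    have h2 := congrArg Finset.card h
    simp only [support, Sum.elim_inl, Sum.elim_inr, Finset.card_singleton] at h2
    omega
  rintro (v | s) (w | t) h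
  · exact congrArg Sum.inl (Subtype.ext (Finset.singleton_injective (Prod.ext_iff.1 h).1))
  · exact absurd (Prod.ext_iff.1 h).1 (hcard v t)
  · exact absurd (Prod.ext_iff.1 h).1.symm (hcard w s)
  · obtain ⟨h1, h2⟩ := Prod.ext_iff.1 h
    have hs := H.mem_positives_inr s
    have ht := H.mem_positives_inr t
    simp only at h1 h2
    rw [h2] at hs
    generalize H.positives (Sum.inr t) = P at hs ht
    obtain ⟨⟨e, η⟩, he⟩ := s
    obtain ⟨⟨f, θ⟩, hf⟩ := t
    obtain rfl : e = f := h1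
    have : η = θ := by
      ext1 v
      have : η v = 1 ↔ θ v = 1 := (hs v).symm.trans (ht v)
      rcases Int.units_eq_one_or (η v) with h | h
      · rw [h, this.1 h]
      · rw [h, (Int.units_eq_one_or (θ v)).resolve_left fun h' => by simp [h] at this; tauto]
    subst this
    rfl

theorem card_le_rank {s : SignedEdge α} (hs : s ∈ H.edges) : s.1.card ≤ H.rank :=
  Finset.le_sup (f := fun s : SignedEdge α => s.1.card) hs

theorem two_le_rank (hne : H.edges.Nonempty) : 2 ≤ H.rank := by
  obtain ⟨s, hs⟩ := hne
  exact (H.two_le_card s hs).trans (H.card_le_rank hs)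

variable [DecidableEq α]

theorem prod_signedLiteral (T : Finset α) (s : H.edges) :
    ∏ v : s.1.1, signedLiteral (s.1.2 v) (if v.1 ∈ T then 1 else 0) =
      patternVector H.support H.positives T (Sum.inr s) := by
  have h1 : ∀ v : s.1.1, signedLiteral (s.1.2 v) (if v.1 ∈ T then 1 else 0) =
      if (v.1 ∈ T ↔ s.1.2 v = 1) then 1 else 0 := by
    intro v
    unfold signedLiteral
    by_cases h : v.1 ∈ T <;> by_cases h' : s.1.2 v = 1 <;> simp [h, h']
  simp_rw [h1]
  have hsub := H.positives_subset_support (Sum.inr s)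
  suffices h2 : (∀ v ∈ (Finset.univ : Finset s.1.1), (v.1 ∈ T ↔ s.1.2 v = 1)) ↔
      T ∩ H.support (Sum.inr s) = H.positives (Sum.inr s) by
    rw [Finset.prod_boole, patternVector]
    simp only [h2]
  constructor
  · intro h
    ext x
    rw [Finset.mem_inter]
    constructor
    · rintro ⟨hx, hxs⟩
      exact (H.mem_positives_inr s ⟨x, hxs⟩).2 ((h ⟨x, hxs⟩ (Finset.mem_univ _)).1 hx)
    · intro hx
      exact ⟨(h ⟨x, hsub hx⟩ (Finset.mem_univ _)).2 ((H.mem_positives_inr s ⟨x, hsub hx⟩).1 hx),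
        hsub hx⟩
  · intro h v _
    rw [← H.mem_positives_inr, ← h, Finset.mem_inter]
    exact ⟨fun hv => ⟨hv, v.2⟩, fun hv => hv.1⟩

theorem patternVector_inl (T : Finset α) (v : H.nodes) :
    patternVector H.support H.positives T (Sum.inl v) = if v.1 ∈ T then 1 else 0 :=
  if_congr (by simp [support, positives]) rfl rfl

theorem pseudoBooleanSet_eq :
    H.pseudoBooleanSet = patternVector H.support H.positives '' {T | T ⊆ H.nodes} := by
  ext z
  constructor
  · rintro ⟨h01, hz⟩
    let T : Finset α := (Finset.univ.filter fun v : H.nodes => z (Sum.inl v) = 1).map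
      (Function.Embedding.subtype (· ∈ H.nodes))
    have hT : ∀ v : H.nodes, z (Sum.inl v) = if v.1 ∈ T then 1 else 0 := by
      intro v
      rcases h01 (Sum.inl v) with h | h <;> simp [T, h]
    refine ⟨T, fun x hx => ?_, ?_⟩
    · obtain ⟨y, -, rfl⟩ := Finset.mem_map.1 hx
      exact y.2
    · ext (v | s)
      · rw [patternVector_inl, hT]
      · rw [hz, ← prod_signedLiteral]
        simp_rw [hT]
  · rintro ⟨T, -, rfl⟩
    refine ⟨fun c => ?_, fun s => ?_⟩
    · unfold patternVector
      split_ifs <;> simp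
    · rw [← prod_signedLiteral]
      simp_rw [patternVector_inl]

theorem exists_extendedFormulation (hne : H.edges.Nonempty)
    (hH : H.underlying.IsAlphaAcyclic) :
    ∃ L : LinearSystem H.Coord,
      L.IsExtendedFormulationOf H.pseudoBooleanPolytope ∧ L.HasZeroOneNegOneData ∧
      L.numVars ≤ H.nodes.card * (2 * 3 ^ (H.rank - 1) + 2 ^ H.rank) ∧
      L.numIneqs ≤ H.nodes.card * (2 * 3 ^ (H.rank - 1) + 2 * 2 ^ H.rank + 1) := by
  have hr : 1 ≤ H.rank := one_le_two.trans (H.two_le_rank hne)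
  obtain ⟨l, hl, hseq⟩ := hH
  obtain ⟨bag, par, ht, hn, hb, he⟩ := hseq.exists_isElimTree hr hl (by
    intro e he
    obtain ⟨s, hs, rfl⟩ := Finset.mem_image.1 he
    exact H.card_le_rank hs)
  change l.length = H.nodes.card at hl
  change l.toFinset = H.nodes at hn
  have : Nonempty α := by
    obtain ⟨s, hs⟩ := hne
    obtain ⟨x, -⟩ := Finset.card_pos.1 (two_pos.trans_le (H.two_le_card s hs))
    exact ⟨x⟩
  have key := ht.exists_extendedFormulation hr hb H.support_positives_injective
    H.positives_subset_support (by
      rintro (v | s)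
      · have hv : v.1 ∈ l := by rw [← List.mem_toFinset, hn]; exact v.2
        exact ⟨v.1, hv, by simp [support], by simpa [support] using ht.mem_bag _ hv⟩
      · exact he _ (Finset.mem_image_of_mem _ s.2))
  rwa [hn, hl, ← pseudoBooleanSet_eq] at key

end SignedHypergraph

/-! ### Size estimates and the main theorem -/

theorem formulation_size_le {r : ℕ} (hr : 2 ≤ r) :
    ((2 * 3 ^ (r - 1) + 2 * 2 ^ r + 1 : ℕ) : ℝ) ≤
      (2 / 3 : ℝ) * 3 ^ r + 2 * ((r : ℝ) - 1) * (2 ^ r + 1) := by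
  obtain ⟨k, rfl⟩ := Nat.exists_eq_add_of_le hr
  rw [show 2 + k - 1 = k + 1 by omega]
  push_cast
  -- With `r = 2 + k`, the right side exceeds the left by `2 * k * (2 ^ r + 1) + 1`.
  have h1 : (0 : ℝ) ≤ k * (2 ^ (2 + k) + 1) := by positivity
  have h2 : (3 : ℝ) ^ (2 + k) = 3 * 3 ^ (k + 1) := by ring
  rw [h2]
  nlinarith

theorem formulation_size_le_four_pow (r : ℕ) :
    2 * 3 ^ (r - 1) + 2 * 2 ^ r + 1 ≤ 5 * 4 ^ r := by
  have h1 : 3 ^ (r - 1) ≤ 4 ^ r :=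
    (Nat.pow_le_pow_left (by norm_num) _).trans (Nat.pow_le_pow_right (by norm_num) (by omega))
  have h2 : 2 ^ r ≤ 4 ^ r := Nat.pow_le_pow_left (by norm_num) _
  have h3 : 1 ≤ 4 ^ r := Nat.one_le_pow _ _ (by norm_num)
  omega

theorem four_pow_le_of_le_log {C : ℝ} {K r m : ℕ} (hK : C * Real.log 4 ≤ K) (hr : 1 ≤ r)
    (h : (r : ℝ) ≤ C * Real.log m) : 4 ^ r ≤ m ^ K := by
  -- For `m = 0` the convention `Real.log 0 = 0` would give `r ≤ 0`.
  have hm : 0 < m := by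
    rcases Nat.eq_zero_or_pos m with rfl | hm
    · have : (1 : ℝ) ≤ r := by exact_mod_cast hr
      simp at h
      omega
    · exact hm
  have hm' : (0 : ℝ) < m := by exact_mod_cast hm
  have hlog : 0 ≤ Real.log m := Real.log_natCast_nonneg m
  have h4 : 0 ≤ Real.log 4 := Real.log_nonneg (by norm_num)
  have : ((4 : ℝ) ^ r) ≤ (m : ℝ) ^ K := by
    rw [← Real.log_le_log_iff (by positivity) (by positivity), Real.log_pow, Real.log_pow]
    calc (r : ℝ) * Real.log 4 ≤ C * Real.log m * Real.log 4 := by gcongr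
      _ = C * Real.log 4 * Real.log m := by ring
      _ ≤ K * Real.log m := by gcongr
  exact_mod_cast this

theorem mainTheorem5 :
    (∀ (α : Type u) [DecidableEq α] (H : SignedHypergraph α),
      H.edges.Nonempty → H.underlying.IsAlphaAcyclic →
      ∃ L : LinearSystem H.Coord,
        L.IsExtendedFormulationOf H.pseudoBooleanPolytope ∧
        L.HasZeroOneNegOneData ∧
        (L.numVars : ℝ) ≤ ((2 / 3 : ℝ) * 3 ^ H.rank +
          2 * ((H.rank : ℝ) - 1) * (2 ^ H.rank + 1)) * (H.nodes.card : ℝ) ∧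
        (L.numIneqs : ℝ) ≤ ((2 / 3 : ℝ) * 3 ^ H.rank +
          2 * ((H.rank : ℝ) - 1) * (2 ^ H.rank + 1)) * (H.nodes.card : ℝ)) ∧
    (∀ (C : ℝ) (p : MvPolynomial (Fin 2) ℕ), ∃ q : MvPolynomial (Fin 2) ℕ,
      ∀ (α : Type u) [DecidableEq α] (H : SignedHypergraph α),
      H.edges.Nonempty → H.underlying.IsAlphaAcyclic →
      (H.rank : ℝ) ≤
        C * Real.log ((MvPolynomial.eval ![H.nodes.card, H.edges.card] p : ℕ) : ℝ) →
      ∃ L : LinearSystem H.Coord,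
        L.IsExtendedFormulationOf H.pseudoBooleanPolytope ∧
        L.HasZeroOneNegOneData ∧
        L.numVars ≤ MvPolynomial.eval ![H.nodes.card, H.edges.card] q ∧
        L.numIneqs ≤ MvPolynomial.eval ![H.nodes.card, H.edges.card] q) := by
  refine ⟨fun α _ H hne hH => ?_, fun C p => ?_⟩
  · obtain ⟨L, h1, h2, h3, h4⟩ := H.exists_extendedFormulation hne hH
    have hr := formulation_size_le (H.two_le_rank hne)
    have key : ∀ n : ℕ, n ≤ H.nodes.card * (2 * 3 ^ (H.rank - 1) + 2 * 2 ^ H.rank + 1) →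
        (n : ℝ) ≤ ((2 / 3 : ℝ) * 3 ^ H.rank +
          2 * ((H.rank : ℝ) - 1) * (2 ^ H.rank + 1)) * (H.nodes.card : ℝ) := by
      intro n hn
      have hn' : (n : ℝ) ≤
          H.nodes.card * ((2 * 3 ^ (H.rank - 1) + 2 * 2 ^ H.rank + 1 : ℕ) : ℝ) := by
        exact_mod_cast hn
      rw [mul_comm]
      exact hn'.trans (by gcongr)
    exact ⟨L, h1, h2, key _ (h3.trans (Nat.mul_le_mul_left _ (by omega))), key _ h4⟩
  · obtain ⟨K, hK⟩ := exists_nat_ge (C * Real.log 4)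
    -- The size is at most `|V| * 5 * 4 ^ r`, and `4 ^ r ≤ p ^ K` as soon as `K ≥ C * log 4`.
    refine ⟨MvPolynomial.X 0 * (MvPolynomial.C 5 * p ^ K), fun α _ H hne hH hr => ?_⟩
    obtain ⟨L, h1, h2, h3, h4⟩ := H.exists_extendedFormulation hne hH
    have h5 := four_pow_le_of_le_log hK (one_le_two.trans (H.two_le_rank hne)) hr
    have h6 := formulation_size_le_four_pow H.rank
    simp only [map_mul, map_pow, MvPolynomial.eval_X, MvPolynomial.eval_C, Matrix.cons_val_zero]
    refine ⟨L, h1, h2, h3.trans (Nat.mul_le_mul_left _ ?_), h4.trans (Nat.mul_le_mul_left _ ?_)⟩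
    · omega
    · omega
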